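/- Let $K$ be a field, let $0<a<b<c$ be integers, put $r=\lceil b/(b-a)\rceil$, and let $I=(x^c,\,x^by^a,\,x^ay^b,\,y^c)\subset S=K[x,y]$ be the symmetric ideal attached to $a,b,c$. Let $\mathfrak m=(x,y)$, let $R(I)=\bigoplus_{k\ge 0}I^k$ be the Rees algebra of $I$, and let $F(I)=R(I)/\mathfrak mR(I)=\bigoplus_{k\ge0}I^k/\mathfrak mI^k$ be the fiber cone of $I$. If $c\notin[2a+1,\;r(b-a)+a]$, then the graded $K$-algebra $F(I)$ is Cohen–Macaulay; that is, $F(I)$ is Noetherian and $\operatorname{depth}F(I)=\dim F(I)$, where $\operatorname{depth}F(I)$ is the supremum of the lengths of $F(I)$-regular sequences contained in the graded maximal ideal $F(I)_+=\bigoplus_{k>0}I^k/\mathfrak mI^k$ and $\dim$ is the Krull dimension. -/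

import Mathlib

/-- The fiber cone `F(I) = R(I) / 𝔪 R(I)` of an ideal `I` with respect to the ideal `𝔪`, where
`R(I) = ⨁ₖ Iᵏ tᵏ ⊆ S[t]` is the Rees algebra of `I`. -/
abbrev FiberCone {S : Type*} [CommRing S] (𝔪 I : Ideal S) : Type _ :=
  reesAlgebra I ⧸ 𝔪.map (algebraMap S (reesAlgebra I))

/-- The ideal `R(I)₊ = ⨁_{k > 0} Iᵏ tᵏ` of the Rees algebra: the elements whose component of
degree zero vanishes. -/
noncomputable def reesIrrelevant {S : Type*} [CommRing S] (I : Ideal S) : Ideal (reesAlgebra I) :=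
  RingHom.ker ((Polynomial.constantCoeff (R := S)).comp (reesAlgebra I).val.toRingHom)

/-- The ideal `F(I)₊ = ⨁_{k > 0} Iᵏ / 𝔪 Iᵏ` of the fiber cone. If `𝔪` is a maximal ideal with
residue field `K`, then `F(I)₀ = K` and this is the graded maximal ideal of `F(I)`. -/
noncomputable def FiberCone.gradedMaximalIdeal {S : Type*} [CommRing S] (𝔪 I : Ideal S) :
    Ideal (FiberCone 𝔪 I) :=
  (reesIrrelevant I).map (Ideal.Quotient.mk (𝔪.map (algebraMap S (reesAlgebra I))))

/-- The depth of the ring `R` with respect to the ideal `J`: the supremum of the lengths of the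
`R`-regular sequences all of whose members lie in `J`. -/
noncomputable def ringDepth {R : Type*} [CommRing R] (J : Ideal R) : ℕ∞ :=
  ⨆ rs : {rs : List R // RingTheory.Sequence.IsRegular R rs ∧ ∀ x ∈ rs, x ∈ J},
    (rs.1.length : ℕ∞)

/-- The Cohen–Macaulay property of a Noetherian nonnegatively graded algebra `R` over a field
`R₀ = K`, with graded maximal ideal `J = R₊`: `depth R = dim R`, the depth being taken with
respect to the graded maximal ideal. -/
def IsGradedCohenMacaulay (R : Type*) [CommRing R] (J : Ideal R) : Prop :=
  IsNoetherianRing R ∧ (ringDepth J : WithBot ℕ∞) = ringKrullDim R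

/-- The graded maximal ideal `(x, y)` of `K[x, y]`. -/
noncomputable def maxIdealXY (K : Type*) [Field K] : Ideal (MvPolynomial (Fin 2) K) :=
  Ideal.span {MvPolynomial.X 0, MvPolynomial.X 1}

/-- The symmetric ideal `(x^c, x^b y^a, x^a y^b, y^c)` of `K[x, y]` attached to `a, b, c`. -/
noncomputable def symmetricIdeal (K : Type*) [Field K] (a b c : ℕ) :
    Ideal (MvPolynomial (Fin 2) K) :=
  Ideal.span {MvPolynomial.X 0 ^ c, MvPolynomial.X 0 ^ b * MvPolynomial.X 1 ^ a,
    MvPolynomial.X 0 ^ a * MvPolynomial.X 1 ^ b, MvPolynomial.X 1 ^ c}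

/-! The fiber cone is shown to be finite and free over a polynomial ring `A = K[Y₀, Y₁]` mapping its
variables into the graded maximal ideal. Then `Y₀, Y₁` stays regular by flatness and the dimension
is at most 2 by integrality, so depth and dimension are both 2.

Write the fiber cone as a quotient of `K[X₀, …, X₃]`, one variable per generator. A monomial dies
when another of the same degree has a strictly smaller exponent vector. If `c ≤ 2a`, the inner
generators lie above the segment joining the outer ones: `X₁²`, `X₁X₂`, `X₂²` die against `X₀X₃`,
and `1, X₁, X₂` is a basis over `K[X₀, X₃]`. Otherwise put `n = r - 1`; the exponents are in
strictly convex position, and `X₀X₃`, `X₀X₂ⁿ`, `X₁ⁿX₃` die against `X₁X₂`, `X₁ⁿ⁺¹`, `X₂ⁿ⁺¹`. With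
`Y₀ = X₀ + X₂`, `Y₁ = X₁ + X₃`, a basis is `X₀, …, X₀ⁿ, 1, X₁, …, X₁ⁿ`.

These relations make the basis span (`span_powerPair_eq_top`). Independence needs no full list of
relations: two maps to rings `A[T]/(p)`, `A[T]/(q)` detect it. They factor through the fiber cone
because every monomial occurring in a kernel element is redundant
(`exists_weight_le_of_fiberConeMap_eq_zero`), and convexity inequalities show that both maps kill
redundant monomials. -/

/-! ### Depth, dimension and finite free extensions of `K[Y₀, Y₁]` -/

open RingTheory.Sequence Module in
theorem RingTheory.Sequence.IsRegular.length_le_supportDim {R : Type*} [CommRing R]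
    [IsNoetherianRing R] {M : Type*} [AddCommGroup M] [Module R M] [Module.Finite R M]
    {rs : List R} (h : IsRegular M rs) : (rs.length : WithBot ℕ∞) ≤ supportDim R M := by
  induction rs generalizing M with
  | nil =>
    have := h.nontrivial
    have h0 : supportDim R M ≠ ⊥ := (supportDim_ne_bot_iff_nontrivial R M).mpr this
    rw [← WithBot.coe_unbot _ h0]
    exact WithBot.coe_le_coe.mpr zero_le
  | cons r rs ih =>
    rw [isRegular_cons_iff] at h
    have h2 := supportDim_quotSMulTop_succ_le_of_notMem_minimalPrimes (R := R) (M := M) (x := r)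
      (fun _ ↦ h.1.notMem_of_mem_minimalPrimes)
    refine le_trans ?_ h2
    have := ih h.2
    rw [List.length_cons]
    push_cast
    gcongr

theorem ringDepth_le_ringKrullDim {R : Type*} [CommRing R] [Nontrivial R] [IsNoetherianRing R]
    (J : Ideal R) : (ringDepth J : WithBot ℕ∞) ≤ ringKrullDim R := by
  have h0 : ringKrullDim R ≠ ⊥ := fun h ↦ by
    simpa [h] using ringKrullDim_nonneg_of_nontrivial (R := R)
  rw [← WithBot.coe_unbot (ringKrullDim R) h0]
  refine WithBot.coe_le_coe.mpr (iSup_le fun rs ↦ WithBot.coe_le_coe.mp ?_)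
  rw [WithBot.coe_unbot, ← Module.supportDim_self_eq_ringKrullDim]
  exact rs.2.1.length_le_supportDim

theorem ringKrullDim_le_of_isIntegral_algebra (A R : Type*) [CommRing A] [CommRing R] [Algebra A R]
    [Algebra.IsIntegral A R] : ringKrullDim R ≤ ringKrullDim A := by
  refine Order.krullDim_le_of_strictMono (PrimeSpectrum.comap (algebraMap A R)) fun p q h ↦ ?_
  exact Ideal.IsIntegral.comap_lt_comap h

theorem MvPolynomial.isRegular_X_zero_X_one (K : Type*) [Field K] :
    RingTheory.Sequence.IsRegular (MvPolynomial (Fin 2) K)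
      [(MvPolynomial.X 0 : MvPolynomial (Fin 2) K), MvPolynomial.X 1] := by
  constructor
  · rw [RingTheory.Sequence.isWeaklyRegular_cons_iff,
      RingTheory.Sequence.isWeaklyRegular_singleton_iff]
    constructor
    · exact (MvPolynomial.isRegular_X (R := K) (n := (0 : Fin 2))).left.isSMulRegular
    · rw [isSMulRegular_iff_right_eq_zero_of_smul]
      intro f hf
      obtain ⟨f, rfl⟩ := Submodule.Quotient.mk_surjective _ f
      rw [← Submodule.Quotient.mk_smul, Submodule.Quotient.mk_eq_zero,
        Submodule.mem_smul_pointwise_iff_exists] at hf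
      rw [Submodule.Quotient.mk_eq_zero, Submodule.mem_smul_pointwise_iff_exists]
      obtain ⟨g, -, hg⟩ := hf
      have hp : Prime (MvPolynomial.X 0 : MvPolynomial (Fin 2) K) := MvPolynomial.X_prime
      rcases hp.dvd_or_dvd (Dvd.intro _ hg : _ ∣ MvPolynomial.X 1 * f) with h | ⟨h, rfl⟩
      · rw [MvPolynomial.X_dvd_X] at h
        exact absurd h (by decide)
      · exact ⟨h, trivial, rfl⟩
  · intro h
    rw [Ideal.smul_eq_mul, Ideal.mul_top] at h
    have h2 : Ideal.ofList [(MvPolynomial.X 0 : MvPolynomial (Fin 2) K), MvPolynomial.X 1] ≤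
        RingHom.ker (MvPolynomial.constantCoeff (σ := Fin 2) (R := K)) := by
      simp [Ideal.span_le, Ideal.ofList_cons, RingHom.mem_ker]
    have := h2 (h ▸ Submodule.mem_top : (1 : MvPolynomial (Fin 2) K) ∈ _)
    simp [RingHom.mem_ker] at this

theorem isGradedCohenMacaulay_of_free (K : Type*) [Field K] {R : Type*} [CommRing R]
    [Algebra (MvPolynomial (Fin 2) K) R] [Nontrivial R] [Module.Free (MvPolynomial (Fin 2) K) R]
    [Module.Finite (MvPolynomial (Fin 2) K) R] (J : Ideal R)
    (hJ : ∀ i : Fin 2, algebraMap (MvPolynomial (Fin 2) K) R (MvPolynomial.X i) ∈ J) :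
    IsGradedCohenMacaulay R J := by
  have hN : IsNoetherianRing R := IsNoetherianRing.of_finite (MvPolynomial (Fin 2) K) R
  refine ⟨hN, le_antisymm (ringDepth_le_ringKrullDim J) ?_⟩
  calc ringKrullDim R ≤ ringKrullDim (MvPolynomial (Fin 2) K) :=
        ringKrullDim_le_of_isIntegral_algebra _ _
    _ = ((2 : ℕ∞) : WithBot ℕ∞) := by
        rw [MvPolynomial.ringKrullDim_of_isNoetherianRing, ringKrullDim_eq_zero_of_field]
        simp
    _ ≤ _ := WithBot.coe_le_coe.mpr ?_
  refine le_iSup_of_le ⟨_, RingTheory.Sequence.IsRegular.of_faithfullyFlat (S := R)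
    (MvPolynomial.isRegular_X_zero_X_one K), ?_⟩ ?_
  · simpa using ⟨hJ 0, hJ 1⟩
  · simp

/-! ### Bases of algebras generated by two elements with `st = cs` -/

open Polynomial in
theorem AdjoinRoot.linearIndependent_root_pow {A : Type*} [CommRing A] {p : A[X]} (hp : p.Monic) :
    LinearIndependent A fun i : Fin p.natDegree ↦ (AdjoinRoot.root p) ^ (i : ℕ) := by
  nontriviality A
  have h := (AdjoinRoot.powerBasis' hp).basis.linearIndependent
  rwa [(AdjoinRoot.powerBasis' hp).coe_basis] at h

section TwoGenerators

open Polynomial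

variable {A R : Type*} [CommRing A] [CommRing R] [Algebra A R]

/-- The powers `s, s², …, sᵐ⁻¹, 1, t, …, tⁿ⁻¹` of two elements. -/
def powerPair (m n : ℕ) (s t : R) : Fin (m - 1) ⊕ Fin n → R :=
  Sum.elim (fun i ↦ s ^ ((i : ℕ) + 1)) (fun j ↦ t ^ (j : ℕ))

/-- Since `ψ` kills `s`, it isolates the coefficients of the powers of `t`; once these vanish, `φ`
isolates those of the powers of `s`. -/
theorem linearIndependent_powerPair {B C : Type*} [CommRing B] [CommRing C] [Algebra A B]
    [Algebra A C] {s t : R} {m n : ℕ} (φ : R →ₐ[A] B)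
    (hφ : LinearIndependent A fun i : Fin m ↦ φ s ^ (i : ℕ)) (ψ : R →ₐ[A] C) (hψs : ψ s = 0)
    (hψt : LinearIndependent A fun j : Fin n ↦ ψ t ^ (j : ℕ)) :
    LinearIndependent A (powerPair m n s t) := by
  rw [Fintype.linearIndependent_iff]
  intro g hg
  simp only [powerPair, Fintype.sum_sum_type, Sum.elim_inl, Sum.elim_inr] at hg
  have h2 : ∀ j, g (Sum.inr j) = 0 := by
    refine Fintype.linearIndependent_iff.mp hψt (fun j ↦ g (Sum.inr j)) ?_
    have := congrArg ψ hg
    simpa only [map_add, map_sum, map_smul, map_pow, hψs, zero_pow (Nat.succ_ne_zero _),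
      smul_zero, Finset.sum_const_zero, zero_add, map_zero] using this
  have h1 : ∀ i, g (Sum.inl i) = 0 := by
    -- The shift skips `s⁰ = 1`, which is already counted among the powers of `t`.
    have hli := hφ.comp (fun i : Fin (m - 1) ↦ (⟨i + 1, by omega⟩ : Fin m))
      (fun i j h ↦ Fin.ext (by simpa using h))
    refine Fintype.linearIndependent_iff.mp hli (fun i ↦ g (Sum.inl i)) ?_
    have := congrArg φ hg
    simpa only [map_add, map_sum, map_smul, map_pow, h2, zero_smul,
      Finset.sum_const_zero, add_zero, map_zero, Function.comp_apply] using this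
  rintro (i | j)
  exacts [h1 i, h2 j]

theorem aeval_mem_of_monic {s : R} {p : A[X]} (hp : p.Monic) (hs : aeval s p = 0)
    {N : Submodule A R} (hN : ∀ i < p.natDegree, s ^ i ∈ N) (f : A[X]) : aeval s f ∈ N := by
  nontriviality R
  have := Module.nontrivial A R
  rw [← aeval_modByMonic_eq_self_of_root (p := f) hs]
  by_cases h0 : f %ₘ p = 0
  · simp [h0]
  rw [aeval_eq_sum_range]
  refine Submodule.sum_mem _ fun i hi ↦ N.smul_mem _ (hN i ?_)
  have h1 := degree_modByMonic_lt f hp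
  have := natDegree_lt_natDegree h0 h1
  rw [Finset.mem_range] at hi
  omega

/-- The relation `st = cs` collapses mixed products, so `A[s] + A[t]` is stable under `s` and `t`
and hence is everything. Division by `p` and `q` bounds the powers needed. -/
theorem span_powerPair_eq_top {s t : R} {c : A} {p q : A[X]} (hp : p.Monic) (hq : q.Monic)
    (hst : s * t = c • s) (hs : aeval s p = 0) (ht : aeval t q = 0)
    (hgen : Algebra.adjoin A {s, t} = ⊤) :
    Submodule.span A (Set.range (powerPair p.natDegree q.natDegree s t)) = ⊤ := by
  set N := Submodule.span A (Set.range (powerPair p.natDegree q.natDegree s t)) with hN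
  have hb (x) : powerPair p.natDegree q.natDegree s t x ∈ N := Submodule.subset_span ⟨x, rfl⟩
  have htN (g : A[X]) : aeval t g ∈ N :=
    aeval_mem_of_monic hq ht (fun i hi ↦ hb (Sum.inr ⟨i, hi⟩)) g
  have hsN (f : A[X]) : aeval s f ∈ N := by
    refine aeval_mem_of_monic hp hs (fun i hi ↦ ?_) f
    rcases i with _ | i
    · simpa using htN 1
    · exact hb (Sum.inl ⟨i, by omega⟩)
  have hst' (g : A[X]) : s * aeval t g = aeval s (C (g.eval c) * X) := by
    induction g using Polynomial.induction_on' with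
    | add f g hf hg => simp only [map_add, mul_add, hf, hg, eval_add, add_mul]
    | monomial n r =>
      have h (n : ℕ) : s * t ^ n = c ^ n • s := by
        induction n with
        | zero => simp
        | succ n ih => rw [pow_succ, ← mul_assoc, ih, smul_mul_assoc, hst, smul_smul, pow_succ]
      rw [aeval_monomial, eval_monomial, map_mul, aeval_C, aeval_X, ← Algebra.smul_def,
        ← Algebra.smul_def, mul_smul_comm, h, smul_smul]
  set M := LinearMap.range (aeval (R := A) s).toLinearMap ⊔
    LinearMap.range (aeval (R := A) t).toLinearMap with hM
  have hMN : M ≤ N := by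
    refine sup_le ?_ ?_
    · rintro _ ⟨f, rfl⟩
      exact hsN f
    · rintro _ ⟨f, rfl⟩
      exact htN f
  have h1M (f : A[X]) : aeval s f ∈ M := Submodule.mem_sup_left ⟨f, rfl⟩
  have h2M (f : A[X]) : aeval t f ∈ M := Submodule.mem_sup_right ⟨f, rfl⟩
  have hsM : ∀ x ∈ M, s * x ∈ M := by
    intro x hx
    obtain ⟨_, ⟨f, rfl⟩, _, ⟨g, rfl⟩, rfl⟩ := Submodule.mem_sup.mp hx
    rw [mul_add]
    refine M.add_mem ?_ ?_
    · have := h1M (X * f)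
      rwa [map_mul, aeval_X] at this
    · simpa only [AlgHom.toLinearMap_apply, hst'] using h1M _
  have htM : ∀ x ∈ M, t * x ∈ M := by
    intro x hx
    obtain ⟨_, ⟨f, rfl⟩, _, ⟨g, rfl⟩, rfl⟩ := Submodule.mem_sup.mp hx
    rw [mul_add]
    refine M.add_mem ?_ ?_
    -- Splitting off the constant term leaves a multiple of `s`, on which `t` acts as `c`.
    · rw [← divX_mul_X_add f]
      have : t * aeval s (f.divX * X + C (f.coeff 0)) =
          c • aeval s (f.divX * X) + aeval t (C (f.coeff 0) * X) := by
        simp only [map_add, map_mul, aeval_X, aeval_C, mul_add]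
        rw [mul_comm (aeval s f.divX) s, ← mul_assoc, mul_comm t s, hst, smul_mul_assoc,
          mul_comm t (algebraMap _ _ _)]
      rw [AlgHom.toLinearMap_apply, this]
      exact M.add_mem (M.smul_mem _ (h1M _)) (h2M _)
    · have := h2M (X * g)
      rwa [map_mul, aeval_X] at this
  refine top_le_iff.mp (le_trans ?_ hMN)
  intro x _
  have hx : x ∈ Algebra.adjoin A {s, t} := hgen ▸ Algebra.mem_top
  suffices ∀ y ∈ M, x * y ∈ M by simpa using this 1 (by simpa using h1M 1)
  induction hx using Algebra.adjoin_induction with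
  | mem x hx =>
    rcases hx with rfl | rfl
    exacts [hsM, htM]
  | algebraMap r =>
    intro y hy
    rw [← Algebra.smul_def]
    exact M.smul_mem _ hy
  | add x y _ _ hx hy =>
    intro z hz
    rw [add_mul]
    exact M.add_mem (hx trivial z hz) (hy trivial z hz)
  | mul x y _ _ hx hy =>
    intro z hz
    rw [mul_assoc]
    exact hx trivial _ (hy trivial z hz)

theorem exists_basis_powerPair {s t : R} {c : A} {p q : A[X]} (hp : p.Monic) (hq : q.Monic)
    (hst : s * t = c • s) (hs : aeval s p = 0) (ht : aeval t q = 0)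
    (hgen : Algebra.adjoin A {s, t} = ⊤)
    (φ : R →ₐ[A] AdjoinRoot p) (hφ : φ s = AdjoinRoot.root p)
    (ψ : R →ₐ[A] AdjoinRoot q) (hψs : ψ s = 0) (hψt : ψ t = AdjoinRoot.root q) :
    Nonempty (Module.Basis (Fin (p.natDegree - 1) ⊕ Fin q.natDegree) A R) :=
  ⟨Module.Basis.mk (linearIndependent_powerPair φ
      (hφ ▸ AdjoinRoot.linearIndependent_root_pow hp) ψ hψs
      (hψt ▸ AdjoinRoot.linearIndependent_root_pow hq))
    (span_powerPair_eq_top hp hq hst hs ht hgen).ge⟩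

end TwoGenerators

/-! ### Fiber cones of monomial ideals and their monomial presentation -/

section MonomialFiberCone

open MvPolynomial

variable {σ ι : Type*} (K : Type*) [Field K] (d : ι → σ →₀ ℕ)

/-- The ideal generated by the monomials with exponents `d i`. -/
noncomputable def monomialIdeal : Ideal (MvPolynomial σ K) :=
  Ideal.span (Set.range fun i ↦ monomial (d i) 1)

theorem monomialIdeal_pow_le (k : ℕ) : monomialIdeal K d ^ k ≤
    Ideal.span ((fun e ↦ monomial e (1 : K)) '' {e | ∃ β : ι →₀ ℕ, β.degree = k ∧
      Finsupp.weight d β = e}) := by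
  induction k with
  | zero =>
    rw [pow_zero, Ideal.one_eq_top, top_le_iff, Ideal.eq_top_iff_one]
    exact Ideal.subset_span ⟨0, ⟨0, by simp, by simp⟩, rfl⟩
  | succ k ih =>
    rw [pow_succ]
    refine (Ideal.mul_mono_left ih).trans ?_
    rw [monomialIdeal, Ideal.span_mul_span', Ideal.span_le]
    rintro _ ⟨_, ⟨_, ⟨β, hβ, rfl⟩, rfl⟩, _, ⟨i, rfl⟩, rfl⟩
    refine Ideal.subset_span ⟨_, ⟨β + Finsupp.single i 1, ?_, rfl⟩, ?_⟩
    · simp [hβ]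
    · simp [monomial_mul, Finsupp.weight_single]

theorem exists_weight_lt_of_mem {f : MvPolynomial σ K} {k : ℕ}
    (hf : f ∈ idealOfVars σ K * monomialIdeal K d ^ k) {e : σ →₀ ℕ} (he : e ∈ f.support) :
    ∃ β : ι →₀ ℕ, β.degree = k ∧ Finsupp.weight d β < e := by
  have h1 := Ideal.mul_mono_right (I := idealOfVars σ K) (monomialIdeal_pow_le K d k) hf
  have h2 : f ∈ Ideal.span ((fun e ↦ monomial e (1 : K)) '' {e | ∃ β : ι →₀ ℕ, β.degree = k ∧
      Finsupp.weight d β < e}) := by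
    revert h1
    rw [idealOfVars, Ideal.span_mul_span']
    refine fun h ↦ Ideal.span_le.mpr ?_ h
    rintro _ ⟨_, ⟨i, rfl⟩, _, ⟨_, ⟨β, hβ, rfl⟩, rfl⟩, rfl⟩
    refine Ideal.subset_span ⟨Finsupp.single i 1 + Finsupp.weight d β, ⟨β, hβ, ?_⟩, ?_⟩
    · refine lt_of_le_of_ne le_add_self fun h ↦ ?_
      have := DFunLike.congr_fun h i
      simp at this
    · simp [X, monomial_mul]
  obtain ⟨e', ⟨β, hβ, h⟩, he'⟩ := mem_ideal_span_monomial_image.mp h2 e he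
  exact ⟨β, hβ, h.trans_le he'⟩

theorem coeff_mem_of_mem_map {S : Type*} [CommRing S] {𝔪 I : Ideal S} {f : reesAlgebra I}
    (hf : f ∈ 𝔪.map (algebraMap S (reesAlgebra I))) (k : ℕ) :
    (f : Polynomial S).coeff k ∈ 𝔪 * I ^ k := by
  induction hf using Submodule.span_induction generalizing k with
  | mem x hx =>
    obtain ⟨m, hm, rfl⟩ := hx
    change (Polynomial.C m).coeff k ∈ _
    rw [Polynomial.coeff_C]
    split_ifs with h
    · subst h
      simpa using hm
    · exact zero_mem _
  | zero => exact zero_mem _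
  | add x y _ _ hx hy => exact add_mem (hx k) (hy k)
  | smul r x _ hx =>
    rw [smul_eq_mul, Subalgebra.coe_mul, Polynomial.coeff_mul]
    refine sum_mem fun ij hij ↦ ?_
    rw [← Finset.HasAntidiagonal.mem_antidiagonal.mp hij, pow_add, mul_left_comm]
    exact Ideal.mul_mem_mul (r.2 _) (hx _)

/-- The generators of the Rees algebra of a monomial ideal. -/
noncomputable def reesGenerator (i : ι) : reesAlgebra (monomialIdeal K d) :=
  ⟨Polynomial.monomial 1 (monomial (d i) 1), reesAlgebra.monomial_mem.mpr <| by
    rw [pow_one]; exact Ideal.subset_span ⟨i, rfl⟩⟩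

theorem coe_aeval_reesGenerator_monomial (α : ι →₀ ℕ) (r : K) :
    (aeval (reesGenerator K d) (monomial α r) : Polynomial (MvPolynomial σ K)) =
      Polynomial.monomial α.degree (monomial (Finsupp.weight d α) r) := by
  induction α using Finsupp.induction_linear generalizing r with
  | zero =>
    rw [monomial_zero', aeval_C]
    simp
  | add α β hα hβ =>
    have : monomial (α + β) r = monomial α r * monomial β (1 : K) := by simp [monomial_mul]
    rw [this, map_mul, Subalgebra.coe_mul, hα, hβ, Polynomial.monomial_mul_monomial, monomial_mul]
    simp
  | single i n =>
    rw [← C_mul_X_pow_eq_monomial, map_mul, map_pow, aeval_C, aeval_X, Subalgebra.coe_mul,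
      Subalgebra.coe_pow]
    change Polynomial.C (C r) * Polynomial.monomial 1 (monomial (d i) 1) ^ n = _
    rw [Polynomial.monomial_pow, Polynomial.C_mul_monomial, monomial_pow, C_mul_monomial]
    simp [Finsupp.weight_single]

theorem coeff_aeval_reesGenerator (p : MvPolynomial ι K) (k : ℕ) (e : σ →₀ ℕ) [DecidableEq σ] :
    ((aeval (reesGenerator K d) p : Polynomial (MvPolynomial σ K)).coeff k).coeff e =
      ∑ α ∈ p.support, if α.degree = k ∧ Finsupp.weight d α = e then p.coeff α else 0 := by
  conv_lhs => rw [p.as_sum]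
  rw [map_sum, AddSubmonoidClass.coe_finsetSum, Polynomial.finsetSum_coeff, coeff_sum]
  refine Finset.sum_congr rfl fun α _ ↦ ?_
  rw [coe_aeval_reesGenerator_monomial, Polynomial.coeff_monomial]
  by_cases h : α.degree = k <;> simp [h, coeff_monomial]

/-- The presentation of the fiber cone of a monomial ideal by its monomial generators. -/
noncomputable def fiberConeMap :
    MvPolynomial ι K →ₐ[K] FiberCone (idealOfVars σ K) (monomialIdeal K d) :=
  (Ideal.Quotient.mkₐ K _).comp (aeval (reesGenerator K d))

/-- If no such `β` existed, no other term could cancel the image of the `α`-term, so its exponent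
would occur in an element of `𝔪 Iᵏ`, `k` the degree of `α`. It would then lie strictly above the
exponent of a product of `k` generators, which provides a `β`. -/
theorem exists_weight_le_of_fiberConeMap_eq_zero {p : MvPolynomial ι K}
    (hp : fiberConeMap K d p = 0) {α : ι →₀ ℕ} (hα : α ∈ p.support) :
    ∃ β, β ≠ α ∧ β.degree = α.degree ∧ Finsupp.weight d β ≤ Finsupp.weight d α := by
  classical
  by_contra! H
  have hp' : aeval (reesGenerator K d) p ∈ (idealOfVars σ K).map
      (algebraMap _ (reesAlgebra (monomialIdeal K d))) := Ideal.Quotient.eq_zero_iff_mem.mp hp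
  have hmem := coeff_mem_of_mem_map hp' α.degree
  obtain ⟨β, hβ, hlt⟩ := exists_weight_lt_of_mem K d hmem (e := Finsupp.weight d α) <| by
    rw [mem_support_iff, coeff_aeval_reesGenerator, Finset.sum_eq_single α]
    · simpa using hα
    · intro β _ hne
      rw [if_neg]
      exact fun h ↦ H β hne h.1 h.2.le
    · exact fun h ↦ absurd hα h
  exact H β (by rintro rfl; exact lt_irrefl _ hlt) hβ hlt.le

theorem fiberConeMap_monomial_eq_zero {β γ : ι →₀ ℕ} (hdeg : γ.degree = β.degree)
    (h : Finsupp.weight d γ < Finsupp.weight d β) (r : K) :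
    fiberConeMap K d (monomial β r) = 0 := by
  refine Ideal.Quotient.eq_zero_iff_mem.mpr ?_
  obtain ⟨δ, hδ⟩ := le_iff_exists_add'.mp h.le
  have hδ0 : δ ≠ 0 := by
    rintro rfl
    simp [hδ] at h
  have : aeval (reesGenerator K d) (monomial β r) =
      algebraMap _ (reesAlgebra (monomialIdeal K d)) (monomial δ (1 : K)) *
        aeval (reesGenerator K d) (monomial γ r) := by
    refine Subtype.ext ?_
    rw [Subalgebra.coe_mul, coe_aeval_reesGenerator_monomial, coe_aeval_reesGenerator_monomial]
    change _ = Polynomial.C (monomial δ 1) * _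
    rw [Polynomial.C_mul_monomial, monomial_mul, hdeg, hδ, one_mul]
  change aeval (reesGenerator K d) (monomial β r) ∈ _
  rw [this]
  refine Ideal.mul_mem_right _ _ (Ideal.mem_map_of_mem _ ?_)
  have := (mem_pow_idealOfVars_iff (σ := σ) (R := K) 1 (monomial δ 1)).mpr (fun x hx ↦ by
    obtain rfl := Finset.mem_singleton.mp (support_monomial_subset hx)
    rw [Nat.one_le_iff_ne_zero]
    simpa [Finsupp.degree_eq_zero_iff] using hδ0)
  rwa [pow_one] at this

/-- Because `𝔪` becomes zero, `S` acts through constant terms; this is why coefficients in `K`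
suffice for surjectivity. -/
theorem mk_algebraMap_fiberCone (s : MvPolynomial σ K) :
    Ideal.Quotient.mk ((idealOfVars σ K).map
      (algebraMap _ (reesAlgebra (monomialIdeal K d)))) (algebraMap _ _ s) =
      fiberConeMap K d (C (constantCoeff s)) := by
  have h : fiberConeMap K d (C (constantCoeff s)) = Ideal.Quotient.mk _
      (algebraMap (MvPolynomial σ K) (reesAlgebra (monomialIdeal K d)) (C (constantCoeff s))) := by
    rw [← algebraMap_eq, AlgHom.commutes]
    rfl
  rw [h, Ideal.Quotient.mk_eq_mk_iff_sub_mem, ← map_sub]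
  refine Ideal.mem_map_of_mem _ ?_
  have := (mem_pow_idealOfVars_iff (σ := σ) (R := K) 1 (s - C (constantCoeff s))).mpr
    (fun x hx ↦ by
      rw [Nat.one_le_iff_ne_zero, Ne, Finsupp.degree_eq_zero_iff]
      rintro rfl
      simp [constantCoeff_eq] at hx)
  rwa [pow_one] at this

theorem fiberConeMap_surjective : Function.Surjective (fiberConeMap K d) := by
  -- Membership is repeated under the existential so that induction can run over polynomials in the
  -- ambient ring.
  suffices H : ∀ f ∈ reesAlgebra (monomialIdeal K d), ∃ p,
      ∃ h : f ∈ reesAlgebra (monomialIdeal K d),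
      fiberConeMap K d p = Ideal.Quotient.mk _ ⟨f, h⟩ by
    intro x
    obtain ⟨⟨f, hf⟩, rfl⟩ := Ideal.Quotient.mk_surjective x
    obtain ⟨p, _, hp⟩ := H f hf
    exact ⟨p, hp⟩
  intro f hf
  rw [← adjoin_monomial_eq_reesAlgebra] at hf
  induction hf using Algebra.adjoin_induction with
  | mem f hf =>
    obtain ⟨r, hr, rfl⟩ := hf
    induction hr using Submodule.span_induction with
    | mem r hr =>
      obtain ⟨i, rfl⟩ := hr
      refine ⟨X i, (reesGenerator K d i).2, ?_⟩
      change Ideal.Quotient.mk _ (aeval (reesGenerator K d) (X i)) = _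
      rw [aeval_X]
      rfl
    | zero =>
      refine ⟨0, by simp, ?_⟩
      have h0 : (⟨Polynomial.monomial 1 0, by simp⟩ : reesAlgebra (monomialIdeal K d)) = 0 :=
        Subtype.ext (map_zero _)
      rw [map_zero, h0, map_zero]
    | add r s _ _ hr hs =>
      obtain ⟨p, hr, hp⟩ := hr
      obtain ⟨q, hs, hq⟩ := hs
      refine ⟨p + q, by rw [map_add]; exact add_mem hr hs, ?_⟩
      rw [map_add, hp, hq, ← map_add]
      congr 1
      exact Subtype.ext (map_add _ _ _).symm
    | smul s r _ hr =>
      obtain ⟨p, hr, hp⟩ := hr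
      refine ⟨C (constantCoeff s) * p, by rw [map_smul]; exact Subalgebra.smul_mem _ hr _, ?_⟩
      rw [map_mul, hp, ← mk_algebraMap_fiberCone, ← map_mul, ← Algebra.smul_def]
      congr 1
      exact Subtype.ext (map_smul _ _ _).symm
  | algebraMap s => exact ⟨_, Subalgebra.algebraMap_mem _ s, (mk_algebraMap_fiberCone K d s).symm⟩
  | add f g _ _ hf hg =>
    obtain ⟨p, hf, hp⟩ := hf
    obtain ⟨q, hg, hq⟩ := hg
    exact ⟨p + q, add_mem hf hg, by rw [map_add, hp, hq]; rfl⟩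
  | mul f g _ _ hf hg =>
    obtain ⟨p, hf, hp⟩ := hf
    obtain ⟨q, hg, hq⟩ := hg
    exact ⟨p * q, mul_mem hf hg, by rw [map_mul, hp, hq]; rfl⟩

theorem fiberConeMap_X_mem (i : ι) : fiberConeMap K d (X i) ∈
    FiberCone.gradedMaximalIdeal (idealOfVars σ K) (monomialIdeal K d) := by
  have : fiberConeMap K d (X i) = Ideal.Quotient.mk _ (reesGenerator K d i) :=
    congrArg (Ideal.Quotient.mk _) (aeval_X _ i)
  rw [this]
  refine Ideal.mem_map_of_mem _ ?_
  change Polynomial.constantCoeff (Polynomial.monomial 1 (monomial (d i) (1 : K))) = 0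
  simp [Polynomial.coeff_monomial]

end MonomialFiberCone

/-! ### A Cohen–Macaulay criterion by generators, relations and two test maps -/

theorem AlgHom.exists_comp_eq_of_ker_le {K P R B : Type*} [CommRing K] [CommRing P] [CommRing R]
    [CommRing B] [Algebra K P] [Algebra K R] [Algebra K B] {π : P →ₐ[K] R}
    (hπ : Function.Surjective π) (φ : P →ₐ[K] B) (h : ∀ x, π x = 0 → φ x = 0) :
    ∃ φ' : R →ₐ[K] B, ∀ x, φ' (π x) = φ x := by
  refine ⟨(Ideal.Quotient.liftₐ (RingHom.ker π) φ fun x hx ↦ h x hx).comp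
    (Ideal.quotientKerAlgEquivOfSurjective hπ).symm.toAlgHom, fun x ↦ ?_⟩
  have : (Ideal.quotientKerAlgEquivOfSurjective hπ).symm (π x) = Ideal.Quotient.mk _ x := by
    rw [AlgEquiv.symm_apply_eq]
    rfl
  exact congrArg (Ideal.Quotient.liftₐ (RingHom.ker π) φ fun x hx ↦ h x hx) this

section FiberConeCriterion

open MvPolynomial

/-- A monomial is redundant if another monomial of the same degree has image of smaller or equal
exponent; such monomials may be killed by a map that factors through the fiber cone. -/
def IsRedundant {σ ι : Type*} (d : ι → σ →₀ ℕ) (α : ι →₀ ℕ) : Prop :=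
  ∃ β, β ≠ α ∧ β.degree = α.degree ∧ Finsupp.weight d β ≤ Finsupp.weight d α

/-- `y` makes `R` an algebra over `K[Y₀, Y₁]`. The relations on `s, t` give spanning, and `φ, ψ`
descend to linear maps that give independence. -/
theorem isGradedCohenMacaulay_of_presentation {ι K R : Type*} [Field K] [CommRing R] [Algebra K R]
    {π : MvPolynomial ι K →ₐ[K] R} (hπ : Function.Surjective π) {J : Ideal R}
    (y : Fin 2 → MvPolynomial ι K) (hy : ∀ i, π (y i) ∈ J) (s t : MvPolynomial ι K)
    (c : MvPolynomial (Fin 2) K) {p q : Polynomial (MvPolynomial (Fin 2) K)} (hp : p.Monic)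
    (hq : q.Monic) (hq0 : 0 < q.natDegree)
    (hst : π (s * t) = π (aeval y c * s))
    (hs : π (p.eval₂ (aeval y : _ →ₐ[K] _).toRingHom s) = 0)
    (ht : π (q.eval₂ (aeval y : _ →ₐ[K] _).toRingHom t) = 0)
    (hgen : ∀ i, X i ∈ Algebra.adjoin K {y 0, y 1, s, t})
    (φ : MvPolynomial ι K →ₐ[K] AdjoinRoot p) (hφy : ∀ i, φ (y i) = AdjoinRoot.of p (X i))
    (hφs : φ s = AdjoinRoot.root p) (hφ : ∀ x, π x = 0 → φ x = 0)
    (ψ : MvPolynomial ι K →ₐ[K] AdjoinRoot q) (hψy : ∀ i, ψ (y i) = AdjoinRoot.of q (X i))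
    (hψs : ψ s = 0) (hψt : ψ t = AdjoinRoot.root q) (hψ : ∀ x, π x = 0 → ψ x = 0) :
    IsGradedCohenMacaulay R J := by
  obtain ⟨φ', hφ'⟩ := AlgHom.exists_comp_eq_of_ker_le hπ φ hφ
  obtain ⟨ψ', hψ'⟩ := AlgHom.exists_comp_eq_of_ker_le hπ ψ hψ
  let _ : Algebra (MvPolynomial (Fin 2) K) R :=
    (π.comp (aeval y)).toRingHom.toAlgebra
  have halg (a : MvPolynomial (Fin 2) K) :
      algebraMap _ R a = π (aeval y a) := rfl
  have hφa : (φ.comp (aeval y)) = IsScalarTower.toAlgHom K (MvPolynomial (Fin 2) K) (AdjoinRoot p) :=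
    MvPolynomial.algHom_ext fun i ↦ by
      simpa using hφy i
  have hψa : (ψ.comp (aeval y)) = IsScalarTower.toAlgHom K (MvPolynomial (Fin 2) K) (AdjoinRoot q) :=
    MvPolynomial.algHom_ext fun i ↦ by
      simpa using hψy i
  let Φ : R →ₐ[MvPolynomial (Fin 2) K] AdjoinRoot p :=
    { φ'.toRingHom with
      commutes' := fun a ↦ (hφ' (aeval y a)).trans (DFunLike.congr_fun hφa a) }
  let Ψ : R →ₐ[MvPolynomial (Fin 2) K] AdjoinRoot q :=
    { ψ'.toRingHom with
      commutes' := fun a ↦ (hψ' (aeval y a)).trans (DFunLike.congr_fun hψa a) }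
  have hadj : Algebra.adjoin (MvPolynomial (Fin 2) K) {π s, π t} = ⊤ := by
    refine top_le_iff.mp fun x _ ↦ ?_
    obtain ⟨f, rfl⟩ := hπ x
    have hC (r : K) : π (algebraMap K _ r) = algebraMap (MvPolynomial (Fin 2) K) _ (C r) := by
      rw [halg, aeval_C]
    have hX (i : Fin 2) : π (y i) = algebraMap (MvPolynomial (Fin 2) K) _ (X i) := by
      rw [halg, aeval_X]
    have key : ∀ g ∈ Algebra.adjoin K {y 0, y 1, s, t},
        π g ∈ Algebra.adjoin (MvPolynomial (Fin 2) K) {π s, π t} := by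
      intro g hg
      induction hg using Algebra.adjoin_induction with
      | mem g hg =>
        rcases hg with rfl | rfl | rfl | rfl
        · rw [hX]; exact Subalgebra.algebraMap_mem _ _
        · rw [hX]; exact Subalgebra.algebraMap_mem _ _
        · exact Algebra.subset_adjoin (by simp)
        · exact Algebra.subset_adjoin (by simp)
      | algebraMap r => rw [hC]; exact Subalgebra.algebraMap_mem _ _
      | add f g _ _ hf hg => rw [map_add]; exact add_mem hf hg
      | mul f g _ _ hf hg => rw [map_mul]; exact mul_mem hf hg
    refine key f ?_
    induction f using MvPolynomial.induction_on with
    | C r => exact Subalgebra.algebraMap_mem _ r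
    | add f g hf hg => exact add_mem (hf trivial) (hg trivial)
    | mul_X f i hf => exact mul_mem (hf trivial) (hgen i)
  have haev (z : MvPolynomial ι K) (f : Polynomial (MvPolynomial (Fin 2) K)) :
      Polynomial.aeval (π z) f = π (f.eval₂ (aeval y : _ →ₐ[K] _).toRingHom z) :=
    (Polynomial.hom_eval₂ f (aeval y : _ →ₐ[K] _).toRingHom π.toRingHom z).symm
  obtain ⟨b⟩ := exists_basis_powerPair hp hq (s := π s) (t := π t) (c := c)
    (by rw [Algebra.smul_def, halg, ← map_mul, ← map_mul, hst]) (by rw [haev, hs])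
    (by rw [haev, ht]) hadj Φ ((hφ' s).trans hφs) Ψ ((hψ' s).trans hψs) ((hψ' t).trans hψt)
  have : Module.Free (MvPolynomial (Fin 2) K) R :=
    Module.Free.of_basis b
  have : Module.Finite (MvPolynomial (Fin 2) K)
      R := Module.Finite.of_basis b
  -- A ring mapping to the nonzero ring `A[T]/(q)` is nonzero; this is where `q` must be
  -- nonconstant.
  have : Nontrivial R :=
    have : Nontrivial (AdjoinRoot q) := AdjoinRoot.nontrivial q
      (by rw [Polynomial.degree_eq_natDegree hq.ne_zero]; exact_mod_cast hq0.ne')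
    Ψ.toRingHom.domain_nontrivial
  refine isGradedCohenMacaulay_of_free K _ fun i ↦ ?_
  rw [halg, aeval_X]
  exact hy i

theorem algHom_eq_zero_of_fiberConeMap_eq_zero {σ ι K B : Type*} [Field K] [CommRing B]
    [Algebra K B] (d : ι → σ →₀ ℕ) (φ : MvPolynomial ι K →ₐ[K] B)
    (hφ : ∀ α, IsRedundant d α → φ (monomial α 1) = 0) (x : MvPolynomial ι K)
    (hx : fiberConeMap K d x = 0) : φ x = 0 := by
  rw [x.as_sum, map_sum]
  refine Finset.sum_eq_zero fun α hα ↦ ?_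
  have : monomial α (x.coeff α) = x.coeff α • monomial α (1 : K) := by
    rw [smul_monomial, smul_eq_mul, mul_one]
  rw [this, map_smul, hφ α (exists_weight_le_of_fiberConeMap_eq_zero K d hx hα), smul_zero]

theorem isGradedCohenMacaulay_fiberCone {σ ι K : Type*} [Field K] (d : ι → σ →₀ ℕ)
    (y : Fin 2 → MvPolynomial ι K) (hy : ∀ i, y i ∈ idealOfVars ι K) (s t : MvPolynomial ι K)
    (c : MvPolynomial (Fin 2) K) {p q : Polynomial (MvPolynomial (Fin 2) K)} (hp : p.Monic)
    (hq : q.Monic) (hq0 : 0 < q.natDegree)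
    (hst : fiberConeMap K d (s * t) = fiberConeMap K d (aeval y c * s))
    (hs : fiberConeMap K d (p.eval₂ (aeval y : _ →ₐ[K] _).toRingHom s) = 0)
    (ht : fiberConeMap K d (q.eval₂ (aeval y : _ →ₐ[K] _).toRingHom t) = 0)
    (hgen : ∀ i, X i ∈ Algebra.adjoin K {y 0, y 1, s, t})
    (φ : MvPolynomial ι K →ₐ[K] AdjoinRoot p) (hφy : ∀ i, φ (y i) = AdjoinRoot.of p (X i))
    (hφs : φ s = AdjoinRoot.root p) (hφ : ∀ α, IsRedundant d α → φ (monomial α 1) = 0)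
    (ψ : MvPolynomial ι K →ₐ[K] AdjoinRoot q) (hψy : ∀ i, ψ (y i) = AdjoinRoot.of q (X i))
    (hψs : ψ s = 0) (hψt : ψ t = AdjoinRoot.root q)
    (hψ : ∀ α, IsRedundant d α → ψ (monomial α 1) = 0) :
    IsGradedCohenMacaulay (FiberCone (idealOfVars σ K) (monomialIdeal K d))
      (FiberCone.gradedMaximalIdeal (idealOfVars σ K) (monomialIdeal K d)) := by
  have hle : idealOfVars ι K ≤ (FiberCone.gradedMaximalIdeal (idealOfVars σ K)
      (monomialIdeal K d)).comap (fiberConeMap K d) :=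
    Ideal.span_le.mpr (Set.range_subset_iff.mpr fun i ↦ fiberConeMap_X_mem K d i)
  exact isGradedCohenMacaulay_of_presentation
    (R := FiberCone (idealOfVars σ K) (monomialIdeal K d)) (π := fiberConeMap K d)
    (fiberConeMap_surjective K d) y (fun i ↦ hle (hy i)) s t c hp hq hq0 hst hs ht hgen
    φ hφy hφs (algHom_eq_zero_of_fiberConeMap_eq_zero d φ hφ)
    ψ hψy hψs hψt (algHom_eq_zero_of_fiberConeMap_eq_zero d ψ hψ)

end FiberConeCriterion

/-! ### Uniqueness of exponents from convexity of the Newton polygon -/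

section ExponentInequalities

variable {a b c : ℤ}

/-- When `a + b < c`, coordinate sum is minimized among the generators exactly on the edge from `(b,
a)` to `(a, b)`. This forces `p' = w' = 0`, and the two coordinates then fix `q'`. -/
theorem exponents_unique_of_inner_edge (hab : a < b) (hc : a + b < c) {q s p' q' s' w' : ℤ}
    (hp' : 0 ≤ p') (hw' : 0 ≤ w') (hdeg : p' + q' + s' + w' = q + s)
    (hx : c * p' + b * q' + a * s' ≤ b * q + a * s)
    (hy : a * q' + b * s' + c * w' ≤ a * q + b * s) :
    p' = 0 ∧ q' = q ∧ s' = s ∧ w' = 0 := by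
  have h1 : (c - a - b) * (p' + w') ≤ 0 := by
    have : q = p' + q' + s' + w' - s := by linarith
    subst this
    nlinarith
  have h2 : p' + w' ≤ 0 := by
    by_contra! h
    nlinarith [mul_pos (show 0 < c - a - b by linarith) h]
  obtain rfl : p' = 0 := by linarith
  obtain rfl : w' = 0 := by linarith
  have h3 : (b - a) * (q' - q) ≤ 0 := by
    have : s = q' + s' - q := by linarith
    subst this
    nlinarith
  have h4 : (b - a) * (q - q') ≤ 0 := by
    have : s = q' + s' - q := by linarith
    subst this
    nlinarith
  have h5 : q' ≤ q := by
    by_contra! h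
    nlinarith [mul_pos (show 0 < b - a by linarith) (show 0 < q' - q by linarith)]
  have h6 : q ≤ q' := by
    by_contra! h
    nlinarith [mul_pos (show 0 < b - a by linarith) (show 0 < q - q' by linarith)]
  exact ⟨rfl, by linarith, by linarith, rfl⟩

/-- The functional `a·x + (c - b)·y` is constant on the edge from `(c, 0)` to `(b, a)`. Its excess
is `(b - a)(c - a - b)` at `(a, b)` and `c(c - a - b)` at `(0, c)`. The bound on `s` makes one use
of `(0, c)`, or a drop of `p'` below `p`, too expensive. -/
theorem exponents_unique_of_outer_edge (ha : 0 < a) (hab : a < b) (hc : a + b < c)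
    {p q s p' q' s' w' : ℤ} (hs' : 0 ≤ s') (hw' : 0 ≤ w')
    (hs : s * (b - a) < a) (hdeg : p' + q' + s' + w' = p + q + s)
    (hx : c * p' + b * q' + a * s' ≤ c * p + b * q + a * s)
    (hy : a * q' + b * s' + c * w' ≤ a * q + b * s) :
    p' = p ∧ q' = q ∧ s' = s ∧ w' = 0 := by
  have h1 : (c - a - b) * (s' * (b - a) + c * w') ≤ (c - a - b) * (s * (b - a)) := by
    have h : q = p' + q' + s' + w' - p - s := by linarith
    have hx' := mul_le_mul_of_nonneg_left hx ha.le
    have hy' := mul_le_mul_of_nonneg_left hy (show 0 ≤ c - b by linarith)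
    subst h
    linarith
  have h2 : s' * (b - a) + c * w' ≤ s * (b - a) :=
    le_of_mul_le_mul_left h1 (by linarith)
  have h3 : w' = 0 := by
    by_contra h
    have : 1 ≤ w' := by omega
    nlinarith [mul_nonneg hs' (show 0 ≤ b - a by linarith)]
  subst h3
  have h4 : s' ≤ s := by
    by_contra! h
    nlinarith [mul_pos (show 0 < b - a by linarith) (show 0 < s' - s by linarith)]
  have hq : q' = p + q + s - p' - s' := by linarith
  subst hq
  have h5 : a * (p - p') ≤ (b - a) * (s - s') := by linarith
  have h6 : (b - a) * (s - s') ≤ (c - b) * (p - p') := by linarith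
  have h7 : p - p' ≤ 0 := by
    by_contra! h
    nlinarith [mul_nonneg hs' (show 0 ≤ b - a by linarith)]
  have h8 : s - s' ≤ 0 := by
    by_contra! h
    nlinarith [mul_pos (show 0 < b - a by linarith) h]
  obtain rfl : s = s' := by linarith
  have h9 : 0 ≤ p - p' := by
    by_contra! h
    nlinarith
  exact ⟨by linarith, by linarith, rfl, rfl⟩

/-- Now coordinate sum favors the outer generators, so a competitor uses at most as many inner ones,
here at most one. The remaining cases follow by comparing multiples of `c` up to an error below `c`.
-/
theorem exponents_unique_of_le_two_mul (ha : 0 < a) (hab : a < b) (hbc : b < c)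
    (hc : c < a + b) {p q s w p' q' s' w' : ℤ} (hq' : 0 ≤ q') (hs' : 0 ≤ s')
    (hq : 0 ≤ q) (hs : 0 ≤ s) (hqs : q + s ≤ 1)
    (hdeg : p' + q' + s' + w' = p + q + s + w)
    (hx : c * p' + b * q' + a * s' ≤ c * p + b * q + a * s)
    (hy : a * q' + b * s' + c * w' ≤ a * q + b * s + c * w) :
    p' = p ∧ q' = q ∧ s' = s ∧ w' = w := by
  have h1 : (a + b - c) * (q' + s') ≤ (a + b - c) * (q + s) := by
    have h : p = p' + q' + s' + w' - q - s - w := by linarith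
    subst h
    linarith
  have h2 : q' + s' ≤ q + s := le_of_mul_le_mul_left h1 (by linarith)
  have hlt {m n x : ℤ} (h : c * m ≤ c * n + x) (hxc : x < c) : m ≤ n := by
    by_contra! h'
    nlinarith
  have hcases : (q' = 0 ∧ s' = 0) ∨ (q' = 1 ∧ s' = 0) ∨ (q' = 0 ∧ s' = 1) := by omega
  have hcases' : (q = 0 ∧ s = 0) ∨ (q = 1 ∧ s = 0) ∨ (q = 0 ∧ s = 1) := by omega
  rcases hcases with ⟨rfl, rfl⟩ | ⟨rfl, rfl⟩ | ⟨rfl, rfl⟩ <;>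
  rcases hcases' with ⟨rfl, rfl⟩ | ⟨rfl, rfl⟩ | ⟨rfl, rfl⟩ <;>
  first
  | (have hp := hlt (m := p') (n := p) (x := b) (by linarith) hbc
     have hw := hlt (m := w') (n := w) (x := b) (by linarith) hbc
     omega)
  | (have hp := hlt (m := p' + 1) (n := p) (x := c + a - b) (by linarith) (by linarith)
     have hw := hlt (m := w') (n := w) (x := b) (by linarith) hbc
     omega)
  | (have hp := hlt (m := p') (n := p) (x := b) (by linarith) hbc
     have hw := hlt (m := w' + 1) (n := w) (x := c + a - b) (by linarith) (by linarith)
     omega)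

end ExponentInequalities

/-! ### Redundant and vanishing monomials for the symmetric ideal -/

section SymmetricIdeal

open MvPolynomial

/-- The exponents of the generators `x^c, x^b y^a, x^a y^b, y^c`. -/
noncomputable def symmetricExponent (a b c : ℕ) : Fin 4 → Fin 2 →₀ ℕ :=
  ![Finsupp.single 0 c, Finsupp.single 0 b + Finsupp.single 1 a,
    Finsupp.single 0 a + Finsupp.single 1 b, Finsupp.single 1 c]

theorem weight_symmetricExponent_zero (a b c : ℕ) (α : Fin 4 →₀ ℕ) :
    Finsupp.weight (symmetricExponent a b c) α 0 = c * α 0 + b * α 1 + a * α 2 := by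
  rw [Finsupp.weight_apply, Finsupp.sum_fintype _ _ (by simp)]
  simp [Fin.sum_univ_four, symmetricExponent, mul_comm]

theorem weight_symmetricExponent_one (a b c : ℕ) (α : Fin 4 →₀ ℕ) :
    Finsupp.weight (symmetricExponent a b c) α 1 = a * α 1 + b * α 2 + c * α 3 := by
  rw [Finsupp.weight_apply, Finsupp.sum_fintype _ _ (by simp)]
  simp [Fin.sum_univ_four, symmetricExponent, mul_comm]

theorem maxIdealXY_eq_idealOfVars (K : Type*) [Field K] : maxIdealXY K = idealOfVars (Fin 2) K := by
  rw [maxIdealXY, idealOfVars]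
  congr 1
  ext f
  simp [Fin.exists_fin_two, eq_comm]

theorem symmetricIdeal_eq_monomialIdeal (K : Type*) [Field K] (a b c : ℕ) :
    symmetricIdeal K a b c = monomialIdeal K (symmetricExponent a b c) := by
  rw [symmetricIdeal, monomialIdeal]
  congr 1
  ext f
  simp only [Set.mem_insert_iff, Set.mem_singleton_iff, Set.mem_range, Fin.exists_fin_succ,
    symmetricExponent, X_pow_eq_monomial]
  simp [monomial_mul, eq_comm]

theorem IsRedundant.exists_exponents {a b c : ℕ} {α : Fin 4 →₀ ℕ}
    (h : IsRedundant (symmetricExponent a b c) α) :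
    ∃ β : Fin 4 →₀ ℕ, β ≠ α ∧
      (β 0 + β 1 + β 2 + β 3 : ℤ) = α 0 + α 1 + α 2 + α 3 ∧
      (c * β 0 + b * β 1 + a * β 2 : ℤ) ≤ c * α 0 + b * α 1 + a * α 2 ∧
      (a * β 1 + b * β 2 + c * β 3 : ℤ) ≤ a * α 1 + b * α 2 + c * α 3 := by
  obtain ⟨β, hne, hdeg, hle⟩ := h
  rw [Finsupp.degree_eq_sum, Finsupp.degree_eq_sum, Fin.sum_univ_four, Fin.sum_univ_four] at hdeg
  have h0 := hle 0
  have h1 := hle 1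
  rw [weight_symmetricExponent_zero, weight_symmetricExponent_zero] at h0
  rw [weight_symmetricExponent_one, weight_symmetricExponent_one] at h1
  exact ⟨β, hne, by exact_mod_cast hdeg, by exact_mod_cast h0, by exact_mod_cast h1⟩

/-- A monomial divisible by none of `X₀X₃`, `X₀X₂ⁿ`, `X₁ⁿX₃` is covered by an edge lemma, the edge
at `(0, c)` by exchanging `x` and `y`. -/
theorem IsRedundant.cases_of_lt {a b c n : ℕ} (ha : 0 < a) (hab : a < b) (hc : a + b < c)
    (hn : n * b < n * a + b) {α : Fin 4 →₀ ℕ} (h : IsRedundant (symmetricExponent a b c) α) :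
    (α 0 ≠ 0 ∧ α 3 ≠ 0) ∨ (α 0 ≠ 0 ∧ n ≤ α 2) ∨ (α 3 ≠ 0 ∧ n ≤ α 1) := by
  obtain ⟨β, hne, hdeg, hx, hy⟩ := h.exists_exponents
  by_contra! H
  obtain ⟨h1, h2, h3⟩ := H
  apply hne
  -- From `n(b - a) < b`, subtracting one `b - a` gives `(n - 1)(b - a) < a`.
  have hlt (m : ℕ) (hm : m < n) : (m : ℤ) * ((b : ℤ) - a) < a := by
    zify at hn hm hab
    nlinarith [mul_le_mul_of_nonneg_right (show (m : ℤ) ≤ n - 1 by omega)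
      (show (0 : ℤ) ≤ b - a by omega)]
  by_cases h0 : α 0 = 0
  · by_cases h3' : α 3 = 0
    · rw [h0] at hdeg hx
      rw [h3'] at hdeg hy
      have := exponents_unique_of_inner_edge (a := a) (b := b) (c := c) (q := α 1) (s := α 2)
        (p' := β 0) (q' := β 1) (s' := β 2) (w' := β 3) (by omega) (by omega) (by omega) (by omega)
        (by simpa using hdeg) (by simpa using hx) (by simpa using hy)
      ext i
      fin_cases i <;> simp <;> omega
    · rw [h0] at hdeg hx
      have := exponents_unique_of_outer_edge (a := a) (b := b) (c := c) (p := α 3) (q := α 2)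
        (s := α 1) (p' := β 3) (q' := β 2) (s' := β 1) (w' := β 0) (by omega) (by omega) (by omega)
        (by omega) (by omega) (hlt _ (h3 h3')) (by push_cast at hdeg; linarith) (by linarith)
        (by push_cast at hx; linarith)
      ext i
      fin_cases i <;> simp <;> omega
  · rw [h1 h0] at hdeg hy
    have := exponents_unique_of_outer_edge (a := a) (b := b) (c := c) (p := α 0) (q := α 1)
      (s := α 2) (p' := β 0) (q' := β 1) (s' := β 2) (w' := β 3) (by omega) (by omega) (by omega)
      (by omega) (by omega) (hlt _ (h2 h0)) (by push_cast at hdeg; linarith) (by linarith)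
      (by push_cast at hy; linarith)
    have := h1 h0
    ext i
    fin_cases i <;> simp <;> omega

theorem IsRedundant.two_le_of_le_two_mul {a b c : ℕ} (ha : 0 < a) (hab : a < b) (hbc : b < c)
    (hc : c ≤ 2 * a) {α : Fin 4 →₀ ℕ} (h : IsRedundant (symmetricExponent a b c) α) :
    2 ≤ α 1 + α 2 := by
  obtain ⟨β, hne, hdeg, hx, hy⟩ := h.exists_exponents
  by_contra! H
  apply hne
  have := exponents_unique_of_le_two_mul (a := a) (b := b) (c := c) (p := α 0) (q := α 1)
    (s := α 2) (w := α 3) (p' := β 0) (q' := β 1) (s' := β 2) (w' := β 3) (by omega) (by omega)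
    (by omega) (by omega) (by omega) (by omega) (by omega) (by omega) (by omega) hdeg hx hy
  ext i
  fin_cases i <;> simp <;> omega

theorem fiberConeMap_prod_X_eq_zero (K : Type*) [Field K] {a b c : ℕ} (i j : Fin 4 → ℕ)
    (hdeg : j 0 + j 1 + j 2 + j 3 = i 0 + i 1 + i 2 + i 3)
    (hx : c * j 0 + b * j 1 + a * j 2 ≤ c * i 0 + b * i 1 + a * i 2)
    (hy : a * j 1 + b * j 2 + c * j 3 ≤ a * i 1 + b * i 2 + c * i 3)
    (hlt : c * j 0 + b * j 1 + a * j 2 + (a * j 1 + b * j 2 + c * j 3) <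
      c * i 0 + b * i 1 + a * i 2 + (a * i 1 + b * i 2 + c * i 3)) :
    fiberConeMap K (symmetricExponent a b c)
      (X 0 ^ i 0 * X 1 ^ i 1 * X 2 ^ i 2 * X 3 ^ i 3) = 0 := by
  have h : (X 0 ^ i 0 * X 1 ^ i 1 * X 2 ^ i 2 * X 3 ^ i 3 : MvPolynomial (Fin 4) K) =
      monomial (Finsupp.equivFunOnFinite.symm i) 1 := by
    rw [monomial_eq, C_1, one_mul, Finsupp.prod_fintype _ _ (by simp), Fin.prod_univ_four]
    rfl
  rw [h]
  refine fiberConeMap_monomial_eq_zero K _ (γ := Finsupp.equivFunOnFinite.symm j) ?_ ?_ 1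
  · rw [Finsupp.degree_eq_sum, Finsupp.degree_eq_sum, Fin.sum_univ_four, Fin.sum_univ_four]
    exact hdeg
  · rw [lt_iff_le_not_ge]
    constructor
    · intro k
      fin_cases k
      · simpa [weight_symmetricExponent_zero] using hx
      · simpa [weight_symmetricExponent_one] using hy
    · intro hle
      have h0 := hle 0
      have h1 := hle 1
      rw [weight_symmetricExponent_zero, weight_symmetricExponent_zero] at h0
      rw [weight_symmetricExponent_one, weight_symmetricExponent_one] at h1
      exact absurd (add_le_add h0 h1) (not_le.mpr hlt)

theorem aeval_monomial_one_fin_four {K B : Type*} [Field K] [CommRing B] [Algebra K B]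
    (f : Fin 4 → B) (α : Fin 4 →₀ ℕ) : aeval f (monomial α (1 : K)) =
      f 0 ^ α 0 * f 1 ^ α 1 * f 2 ^ α 2 * f 3 ^ α 3 := by
  rw [aeval_monomial, map_one, one_mul, Finsupp.prod_fintype _ _ (by simp), Fin.prod_univ_four]

end SymmetricIdeal

/-! ### The two ranges of `c` -/

section CohenMacaulay

open MvPolynomial

theorem isGradedCohenMacaulay_symmetric_of_le_two_mul {K : Type*} [Field K] {a b c : ℕ}
    (ha : 0 < a) (hab : a < b) (hbc : b < c) (hc : c ≤ 2 * a) :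
    IsGradedCohenMacaulay
      (FiberCone (idealOfVars (Fin 2) K) (monomialIdeal K (symmetricExponent a b c)))
      (FiberCone.gradedMaximalIdeal (idealOfVars (Fin 2) K)
        (monomialIdeal K (symmetricExponent a b c))) := by
  have hp : (Polynomial.X ^ 2 : Polynomial (MvPolynomial (Fin 2) K)).Monic :=
    Polynomial.monic_X_pow 2
  have hroot : AdjoinRoot.root (Polynomial.X ^ 2 : Polynomial (MvPolynomial (Fin 2) K)) ^ 2 = 0 := by
    rw [← AdjoinRoot.mk_X, ← map_pow]
    exact AdjoinRoot.mk_self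
  have hpow {n : ℕ} (hn : 2 ≤ n) :
      AdjoinRoot.root (Polynomial.X ^ 2 : Polynomial (MvPolynomial (Fin 2) K)) ^ n = 0 :=
    pow_eq_zero_of_le hn hroot
  have hzero (i : Fin 4 → ℕ) (h0 : i 0 = 0) (h3 : i 3 = 0) (h12 : i 1 + i 2 = 2) :
      fiberConeMap K (symmetricExponent a b c)
        (X 0 ^ i 0 * X 1 ^ i 1 * X 2 ^ i 2 * X 3 ^ i 3) = 0 := by
    have h1 : i 2 = 2 - i 1 := by omega
    have h2 : i 1 ≤ 2 := by omega
    refine fiberConeMap_prod_X_eq_zero K i ![1, 0, 0, 1] ?_ ?_ ?_ ?_ <;>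
      simp only [h0, h1, h3, Matrix.cons_val] <;> interval_cases i 1 <;> omega
  -- Each test map keeps one inner variable, as a root of `T²`, and kills the other.
  refine isGradedCohenMacaulay_fiberCone _ ![X 0, X 3] ?_ (X 1) (X 2) 0 hp hp ?_ ?_ ?_ ?_ ?_
    (aeval ![AdjoinRoot.of _ (X 0), AdjoinRoot.root _, 0, AdjoinRoot.of _ (X 1)]) ?_ ?_ ?_
    (aeval ![AdjoinRoot.of _ (X 0), 0, AdjoinRoot.root _, AdjoinRoot.of _ (X 1)]) ?_ ?_ ?_ ?_
  · intro i
    fin_cases i <;> exact Ideal.subset_span ⟨_, rfl⟩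
  · simp
  · simpa only [Matrix.cons_val, pow_zero, pow_one, one_mul, mul_one, map_zero, zero_mul] using
      hzero ![0, 1, 1, 0] rfl rfl rfl
  · simpa only [Matrix.cons_val, pow_zero, one_mul, mul_one, Polynomial.eval₂_X_pow] using
      hzero ![0, 2, 0, 0] rfl rfl rfl
  · simpa only [Matrix.cons_val, pow_zero, one_mul, mul_one, Polynomial.eval₂_X_pow] using
      hzero ![0, 0, 2, 0] rfl rfl rfl
  · intro i
    fin_cases i <;> exact Algebra.subset_adjoin (by simp)
  · intro i
    fin_cases i <;> simp
  · simp
  · intro α hα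
    have := hα.two_le_of_le_two_mul ha hab hbc hc
    rw [aeval_monomial_one_fin_four]
    by_cases h : α 2 = 0
    · simp [hpow (show 2 ≤ α 1 by omega)]
    · simp [h]
  · intro i
    fin_cases i <;> simp
  · simp
  · simp
  · intro α hα
    have := hα.two_le_of_le_two_mul ha hab hbc hc
    rw [aeval_monomial_one_fin_four]
    by_cases h : α 1 = 0
    · simp [hpow (show 2 ≤ α 2 by omega)]
    · simp [h]

/-- The hypotheses say `n(b - a) < b ≤ (n + 1)(b - a)` and `(n + 1)(b - a) + a < c`: the first bound
controls redundancy, the other two make `X₀X₂ⁿ` and `X₁ⁿX₃` vanish. -/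
theorem isGradedCohenMacaulay_symmetric_of_lt {K : Type*} [Field K] {a b c n : ℕ}
    (ha : 0 < a) (hab : a < b) (hn : n * b < n * a + b) (hn' : (n + 1) * a ≤ n * b)
    (hc : (n + 1) * b < c + n * a) :
    IsGradedCohenMacaulay
      (FiberCone (idealOfVars (Fin 2) K) (monomialIdeal K (symmetricExponent a b c)))
      (FiberCone.gradedMaximalIdeal (idealOfVars (Fin 2) K)
        (monomialIdeal K (symmetricExponent a b c))) := by
  have hc' : a + b < c := by nlinarith
  have hn0 : n ≠ 0 := by
    rintro rfl
    omega
  set p : Polynomial (MvPolynomial (Fin 2) K) :=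
    Polynomial.X * (Polynomial.X - Polynomial.C (X 0)) ^ n with hp
  set q : Polynomial (MvPolynomial (Fin 2) K) :=
    Polynomial.X ^ n * (Polynomial.X - Polynomial.C (X 1)) with hq
  have hpm : p.Monic := Polynomial.monic_X.mul ((Polynomial.monic_X_sub_C _).pow n)
  have hqm : q.Monic := (Polynomial.monic_X_pow n).mul (Polynomial.monic_X_sub_C _)
  have hqd : q.natDegree = n + 1 := by
    rw [hq, (Polynomial.monic_X_pow n).natDegree_mul (Polynomial.monic_X_sub_C _),
      Polynomial.natDegree_X_pow, Polynomial.natDegree_X_sub_C]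
  have hpr : AdjoinRoot.root p * (AdjoinRoot.of p (X 0) - AdjoinRoot.root p) ^ n = 0 := by
    have h : AdjoinRoot.root p * (AdjoinRoot.root p - AdjoinRoot.of p (X 0)) ^ n = 0 := by
      rw [← AdjoinRoot.mk_X, ← AdjoinRoot.mk_C, ← map_sub, ← map_pow, ← map_mul]
      exact AdjoinRoot.mk_self
    rw [← neg_sub, neg_pow, mul_left_comm, h, mul_zero]
  have hqr : AdjoinRoot.root q ^ n * (AdjoinRoot.of q (X 1) - AdjoinRoot.root q) = 0 := by
    have h : AdjoinRoot.root q ^ n * (AdjoinRoot.root q - AdjoinRoot.of q (X 1)) = 0 := by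
      rw [← AdjoinRoot.mk_X, ← AdjoinRoot.mk_C, ← map_sub, ← map_pow, ← map_mul]
      exact AdjoinRoot.mk_self
    rw [← neg_sub, mul_neg, h, neg_zero]
  have h03 : fiberConeMap K (symmetricExponent a b c) (X 0 * X 3) = 0 := by
    simpa only [Matrix.cons_val, pow_zero, pow_one, one_mul, mul_one] using
      fiberConeMap_prod_X_eq_zero K ![1, 0, 0, 1] ![0, 1, 1, 0] rfl
      (by simp; omega) (by simp; omega) (by simp; omega)
  have h02 : fiberConeMap K (symmetricExponent a b c) (X 0 * X 2 ^ n) = 0 := by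
    simpa only [Matrix.cons_val, pow_zero, pow_one, one_mul, mul_one] using
      fiberConeMap_prod_X_eq_zero K ![1, 0, n, 0] ![0, n + 1, 0, 0] (by simp; omega)
      (by simp; linarith) (by simp; linarith) (by simp; linarith)
  have h13 : fiberConeMap K (symmetricExponent a b c) (X 1 ^ n * X 3) = 0 := by
    simpa only [Matrix.cons_val, pow_zero, pow_one, one_mul, mul_one] using
      fiberConeMap_prod_X_eq_zero K ![0, n, 0, 1] ![0, 0, n + 1, 0] (by simp)
      (by simp; linarith) (by simp; linarith) (by simp; linarith)
  -- Modulo `X₀X₃`, `X₀X₁ = Y₁X₀`. Substituting `X₂ = Y₀ - X₀` and `X₃ = Y₁ - X₁` turns the other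
  -- relations into `p` and `q` up to sign. The test maps set `X₃ = 0` and `X₀ = 0`, respectively.
  refine isGradedCohenMacaulay_fiberCone _ ![X 0 + X 2, X 1 + X 3] ?_ (X 0) (X 1) (X 1) hpm hqm
    (by omega) ?_ ?_ ?_ ?_
    (aeval ![AdjoinRoot.root _, AdjoinRoot.of _ (X 1),
      AdjoinRoot.of _ (X 0) - AdjoinRoot.root _, 0]) ?_ ?_ ?_
    (aeval ![0, AdjoinRoot.root _, AdjoinRoot.of _ (X 0),
      AdjoinRoot.of _ (X 1) - AdjoinRoot.root _]) ?_ ?_ ?_ ?_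
  · intro i
    fin_cases i <;> exact add_mem (Ideal.subset_span ⟨_, rfl⟩) (Ideal.subset_span ⟨_, rfl⟩)
  · have h : aeval ![X 0 + X 2, X 1 + X 3] (X 1 : MvPolynomial (Fin 2) K) * X 0 =
        (X 0 * X 1 + X 0 * X 3 : MvPolynomial (Fin 4) K) := by
      rw [aeval_X]
      simp
      ring
    rw [h, map_add, h03, add_zero]
  · have h : p.eval₂ (aeval ![X 0 + X 2, X 1 + X 3] : _ →ₐ[K] MvPolynomial (Fin 4) K).toRingHom
        (X 0) = ((-1) ^ n * (X 0 * X 2 ^ n) : MvPolynomial (Fin 4) K) := by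
      simp [hp, Polynomial.eval₂_mul, Polynomial.eval₂_pow, neg_pow (X 2 : MvPolynomial (Fin 4) K)]
      ring
    rw [h, map_mul, h02, mul_zero]
  · have h : q.eval₂ (aeval ![X 0 + X 2, X 1 + X 3] : _ →ₐ[K] MvPolynomial (Fin 4) K).toRingHom
        (X 1) = (-1 * (X 1 ^ n * X 3) : MvPolynomial (Fin 4) K) := by
      simp [hq, Polynomial.eval₂_mul, Polynomial.eval₂_pow]
    rw [h, map_mul, h13, mul_zero]
  · have hsub (i j k : Fin 4) (S : Set (MvPolynomial (Fin 4) K)) (h : X j + X i ∈ S)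
        (hj : X j ∈ S) : X i ∈ Algebra.adjoin K S := by
      rw [← add_sub_cancel_left (X j) (X i)]
      exact sub_mem (Algebra.subset_adjoin h) (Algebra.subset_adjoin hj)
    intro i
    fin_cases i
    · exact Algebra.subset_adjoin (by simp)
    · exact Algebra.subset_adjoin (by simp)
    · exact hsub 2 0 0 _ (by simp) (by simp)
    · exact hsub 3 1 0 _ (by simp) (by simp)
  · intro i
    fin_cases i <;> simp
  · simp
  · intro α hα
    rw [aeval_monomial_one_fin_four]
    by_cases h3 : α 3 = 0
    · obtain ⟨h0, h2⟩ : α 0 ≠ 0 ∧ n ≤ α 2 := by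
        have := hα.cases_of_lt ha hab hc' hn
        tauto
      obtain ⟨k, hk⟩ := Nat.exists_eq_succ_of_ne_zero h0
      obtain ⟨l, hl⟩ := Nat.exists_eq_add_of_le h2
      simp only [Matrix.cons_val, hk, hl, h3, pow_succ, pow_add]
      linear_combination (AdjoinRoot.root p ^ k * AdjoinRoot.of p (X 1) ^ α 1 *
        (AdjoinRoot.of p (X 0) - AdjoinRoot.root p) ^ l) * hpr
    · simp [h3]
  · intro i
    fin_cases i <;> simp
  · simp
  · simp
  · intro α hα
    rw [aeval_monomial_one_fin_four]
    by_cases h0 : α 0 = 0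
    · obtain ⟨h3, h1⟩ : α 3 ≠ 0 ∧ n ≤ α 1 := by
        have := hα.cases_of_lt ha hab hc' hn
        tauto
      obtain ⟨k, hk⟩ := Nat.exists_eq_succ_of_ne_zero h3
      obtain ⟨l, hl⟩ := Nat.exists_eq_add_of_le h1
      simp only [Matrix.cons_val, hk, hl, h0, pow_succ, pow_add]
      linear_combination (AdjoinRoot.root q ^ l * AdjoinRoot.of q (X 0) ^ α 2 *
        (AdjoinRoot.of q (X 1) - AdjoinRoot.root q) ^ k) * hqr
    · simp [h0]

end CohenMacaulay

theorem corollary3p7 {K : Type*} [Field K] (a b c : ℕ)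
    (ha : 0 < a) (hab : a < b) (hbc : b < c)
    (hc : (c : ℤ) ∉ Set.Icc (2 * (a : ℤ) + 1)
      (⌈(b : ℚ) / ((b : ℚ) - (a : ℚ))⌉ * ((b : ℤ) - (a : ℤ)) + (a : ℤ))) :
    IsGradedCohenMacaulay (FiberCone (maxIdealXY K) (symmetricIdeal K a b c))
      (FiberCone.gradedMaximalIdeal (maxIdealXY K) (symmetricIdeal K a b c)) := by
  rw [maxIdealXY_eq_idealOfVars, symmetricIdeal_eq_monomialIdeal]
  rw [Set.mem_Icc, not_and_or, not_le, not_le] at hc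
  rcases hc with hc | hc
  · exact isGradedCohenMacaulay_symmetric_of_le_two_mul ha hab hbc (by omega)
  · have hpos : (0 : ℚ) < b - a := by
      rw [sub_pos]
      exact_mod_cast hab
    set r := ⌈(b : ℚ) / ((b : ℚ) - (a : ℚ))⌉ with hr
    have h1 : (b : ℤ) ≤ r * (b - a) := by
      have := Int.le_ceil ((b : ℚ) / ((b : ℚ) - (a : ℚ)))
      rw [← hr, div_le_iff₀ hpos] at this
      exact_mod_cast this
    have h2 : (r - 1) * (b - a) < (b : ℤ) := by
      have := Int.ceil_lt_add_one ((b : ℚ) / ((b : ℚ) - (a : ℚ)))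
      rw [← hr, ← sub_lt_iff_lt_add, lt_div_iff₀ hpos] at this
      exact_mod_cast this
    have h3 : 1 ≤ r := by
      by_contra! h
      nlinarith
    -- With `n = r - 1`, the ceiling bounds become `n(b - a) < b ≤ (n + 1)(b - a)`.
    obtain ⟨n, hn⟩ := Int.eq_ofNat_of_zero_le (show 0 ≤ r - 1 by omega)
    clear_value r
    obtain rfl : r = n + 1 := by linarith
    refine isGradedCohenMacaulay_symmetric_of_lt (n := n) ha hab ?_ ?_ ?_ <;> zify <;> linarith
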